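/- Let $q$ be an odd prime, let $K=\mathbb{Q}(\xi)$ where $\xi$ is a primitive $q$-th root of unity, let $\alpha\in K^{*}$, and let $L=K(\sqrt[q]{\alpha})$, with ring of integers $\mathcal{O}_L$ and ideal class group $Cl(L)$. Let $\pi$ be a prime element of $\mathbb{Z}[\xi]$ which does not divide $q$, and suppose that $\alpha$ is a $q$-th power residue modulo $\pi$; that is, $\alpha=a/b$ with $a,b\in\mathbb{Z}[\xi]$ not divisible by $\pi$, and $a\equiv b\,x^{q}\pmod{\pi}$ for some $x\in\mathbb{Z}[\xi]$. Let $P$ be a prime ideal of $\mathcal{O}_L$ dividing $\pi\mathcal{O}_L$, and let $h_\pi$ be the order of the class of $P$ in $Cl(L)$. For $\beta\in K^{*}$ let $\left(\frac{\alpha,\,\beta}{K,\xi}\right)$ denote the symbol algebra, i.e. the $K$-algebra generated by $x,y$ subject to $x^{q}=\alpha$, $y^{q}=\beta$, $yx=\xi xy$; it is said to split if it is isomorphic to a full matrix algebra over $K$. Then: a) there exists a unit $u$ of $\mathbb{Z}[\xi]$ such that the symbol algebra $\left(\frac{\alpha,\;u\cdot\pi^{h_\pi}}{K,\xi}\right)$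 splits; b) there exists a unit $u$ of $\mathbb{Z}[\xi]$ such that the symbol algebra $\left(\frac{\alpha,\;u\cdot\pi^{\gcd(h_\pi,q)}}{K,\xi}\right)$ splits. -/

import Mathlib

open scoped NumberField nonZeroDivisors

/-- The defining relations `x ^ n = a`, `y ^ n = b`, `y x = ξ x y` of a symbol algebra, on the
free algebra over `F` with generators `x = ι 0` and `y = ι 1`. -/
inductive SymbolAlgebra.Rel {F : Type*} [Field F] (n : ℕ) (ξ a b : F) :
    FreeAlgebra F (Fin 2) → FreeAlgebra F (Fin 2) → Prop
  | x_pow : SymbolAlgebra.Rel n ξ a b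
      (FreeAlgebra.ι F 0 ^ n) (algebraMap F (FreeAlgebra F (Fin 2)) a)
  | y_pow : SymbolAlgebra.Rel n ξ a b
      (FreeAlgebra.ι F 1 ^ n) (algebraMap F (FreeAlgebra F (Fin 2)) b)
  | comm : SymbolAlgebra.Rel n ξ a b
      (FreeAlgebra.ι F 1 * FreeAlgebra.ι F 0)
      (ξ • (FreeAlgebra.ι F 0 * FreeAlgebra.ι F 1))

/-- The symbol algebra `(a, b / F, ξ)` of degree `n`: the `F`-algebra generated by `x`, `y` subject
to `x ^ n = a`, `y ^ n = b`, `y x = ξ x y`. -/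
abbrev SymbolAlgebra {F : Type*} [Field F] (n : ℕ) (ξ a b : F) : Type _ :=
  RingQuot (SymbolAlgebra.Rel n ξ a b)

/-- An `F`-algebra is split (over `F`) if it is isomorphic to a full matrix algebra over `F`. -/
def IsSplitAlgebra (F A : Type*) [Field F] [Ring A] [Algebra F A] : Prop :=
  ∃ m : ℕ, 0 < m ∧ Nonempty (A ≃ₐ[F] Matrix (Fin m) (Fin m) F)

/-- `α`, an element of a field `K` containing `R`, is an `n`-th power residue modulo `π ∈ R`:
`α` is a unit at `π`, that is a quotient `a / b` of elements of `R` not divisible by `π`, and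
`α ≡ x ^ n` modulo `π` (that is, `a ≡ b x ^ n` modulo `π`) for some `x ∈ R`.
Here `R` is meant to be a Dedekind domain with fraction field `K`, and `π` a prime element. -/
def IsPowerResidueMod {R K : Type*} [CommRing R] [Field K] [Algebra R K]
    (n : ℕ) (π : R) (α : K) : Prop :=
  ∃ a b x : R, ¬ π ∣ a ∧ ¬ π ∣ b ∧ α * algebraMap R K b = algebraMap R K a ∧
    π ∣ a - b * x ^ n

/-! If `α` is not a `q`-th power in `K`, then `L/K` is cyclic of degree `q`, with a generator `σ`
such that `σ θ = ξ θ`. For `ρ ≠ 0` in `L`, the algebra `(α, N ρ)` acts on the `K`-space `L`, with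
`x` acting as multiplication by `θ` and `y` as `v ↦ ρ σ(v)`. The `q ^ 2` monomials act
independently, so the action is an isomorphism onto `End_K(L)` (`isSplitAlgebra_norm`).

It remains to produce norms. The residue condition makes the decomposition group of `P` trivial
(`stabilizer_eq_bot_of_isPowerResidueMod`), so `P` has norm `(π)` and a generator of `P ^ h` has
norm `u π ^ h` (`exists_norm_eq_unit_mul_pow`), which gives a). As `N π = π ^ q`, Bézout gives b).
If `α` is a `q`-th power, `K ^ q` with the cyclic shift replaces `L` (`isSplitAlgebra_pow`). -/

namespace SymbolAlgebra

variable {F : Type*} [Field F]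

/-! ### Independence of monomials from the defining relations -/

section Relations

variable {A : Type*} [Ring A] [Algebra F A] {ξ : F} {x y : A}

theorem mul_pow_of_comm (h : y * x = ξ • (x * y)) (i : ℕ) :
    y * x ^ i = ξ ^ i • (x ^ i * y) := by
  induction i with
  | zero => simp
  | succ i ih =>
    rw [pow_succ, ← mul_assoc, ih, smul_mul_assoc, mul_assoc, h, mul_smul_comm, smul_smul,
      ← pow_succ, mul_assoc]

theorem pow_mul_of_comm (h : y * x = ξ • (x * y)) (j : ℕ) :
    y ^ j * x = ξ ^ j • (x * y ^ j) := by
  induction j with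
  | zero => simp
  | succ j ih =>
    rw [pow_succ, mul_assoc, h, mul_smul_comm, ← mul_assoc, ih, smul_mul_assoc, smul_smul,
      ← pow_succ', mul_assoc]

/-- Vectors in distinct eigenspaces that add up to zero are all zero. -/
theorem eq_zero_of_sum_eigenvectors_eq_zero {V ι : Type*} [AddCommGroup V] [Module F V]
    [Fintype ι] (f : Module.End F V) (μ : ι → F) (hμ : Function.Injective μ) (v : ι → V)
    (hv : ∀ i, f (v i) = μ i • v i) (hsum : ∑ i, v i = 0) (i : ι) : v i = 0 := by
  have hind : iSupIndep fun i ↦ f.eigenspace (μ i) := f.eigenspaces_iSupIndep.comp hμ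
  exact (iSupIndep_iff_finsetSum_eq_zero_imp_eq_zero _).1 hind Finset.univ v
    (fun i _ ↦ Module.End.mem_eigenspace_iff.2 (hv i)) hsum i (Finset.mem_univ i)

/-- The monomials `x ^ i y ^ j` with `i, j < n` are linearly independent. -/
theorem linearIndependent_monomials [Nontrivial A] {n : ℕ} (hn : 0 < n)
    (hξ : IsPrimitiveRoot ξ n) {a b : F} (ha : a ≠ 0) (hb : b ≠ 0)
    (hx : x ^ n = algebraMap F A a) (hy : y ^ n = algebraMap F A b)
    (h : y * x = ξ • (x * y)) :
    LinearIndependent F fun p : Fin n × Fin n ↦ x ^ (p.1 : ℕ) * y ^ (p.2 : ℕ) := by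
  have hux : IsUnit x := (isUnit_pow_iff hn.ne').1 (hx ▸ (ha.isUnit.map (algebraMap F A)))
  have huy : IsUnit y := (isUnit_pow_iff hn.ne').1 (hy ▸ (hb.isUnit.map (algebraMap F A)))
  have hinj {a : F} (ha : a ≠ 0) : Function.Injective fun i : Fin n ↦ ξ ^ (i : ℕ) * a :=
    fun i j hij ↦ Fin.ext (hξ.pow_inj i.2 j.2 (mul_right_cancel₀ ha hij))
  rw [Fintype.linearIndependent_iff]
  intro c hc
  rw [Fintype.sum_prod_type_right] at hc
  -- Since `x ^ (n - 1) = a x⁻¹`, the map `v ↦ x ^ (n - 1) v x` is a scaled conjugation; it has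
  -- eigenvalue `ξ ^ j a` on `x ^ i y ^ j`, which separates the powers of `y`.
  have hcol (j : Fin n) : ∑ i, c (i, j) • x ^ (i : ℕ) = 0 := by
    have key := eq_zero_of_sum_eigenvectors_eq_zero
      (LinearMap.mulLeft F (x ^ (n - 1)) ∘ₗ LinearMap.mulRight F x)
      (fun j : Fin n ↦ ξ ^ (j : ℕ) * a) (hinj ha)
      (fun j ↦ ∑ i, c (i, j) • (x ^ (i : ℕ) * y ^ (j : ℕ))) (fun j ↦ ?_) hc j
    · simp_rw [← smul_mul_assoc, ← Finset.sum_mul] at key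
      exact (huy.pow _).mul_left_eq_zero.1 key
    · rw [map_sum, Finset.smul_sum]
      refine Finset.sum_congr rfl fun i _ ↦ ?_
      rw [map_smul, smul_comm]
      congr 1
      rw [LinearMap.comp_apply, LinearMap.mulRight_apply, LinearMap.mulLeft_apply, mul_assoc,
        pow_mul_of_comm h, mul_smul_comm, mul_smul_comm, mul_smul, ← mul_assoc _ x, ← pow_succ,
        pow_succ', ← mul_assoc, ← mul_assoc, ← pow_succ, Nat.sub_add_cancel hn, hx,
        mul_assoc, ← Algebra.smul_def]
  rintro ⟨i, j⟩
  -- Likewise `v ↦ y v y ^ (n - 1)` separates the powers of `x`.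
  have key := eq_zero_of_sum_eigenvectors_eq_zero
    (LinearMap.mulRight F (y ^ (n - 1)) ∘ₗ LinearMap.mulLeft F y)
    (fun i : Fin n ↦ ξ ^ (i : ℕ) * b) (hinj hb)
    (fun i ↦ c (i, j) • x ^ (i : ℕ)) (fun i ↦ ?_) (hcol j) i
  · exact (smul_eq_zero.1 key).resolve_right (hux.pow _).ne_zero
  · rw [map_smul, smul_comm]
    congr 1
    rw [LinearMap.comp_apply, LinearMap.mulRight_apply, LinearMap.mulLeft_apply,
      mul_pow_of_comm h, smul_mul_assoc, mul_assoc, ← pow_succ', Nat.sub_add_cancel hn, hy,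
      ← Algebra.commutes, ← Algebra.smul_def, smul_smul]

end Relations

/-! ### Generators, spanning monomials and representations -/

variable (n : ℕ) (ξ a b : F)

/-- The generator `x` of the symbol algebra. -/
noncomputable def genX : SymbolAlgebra n ξ a b :=
  RingQuot.mkAlgHom F (Rel n ξ a b) (FreeAlgebra.ι F 0)

/-- The generator `y` of the symbol algebra. -/
noncomputable def genY : SymbolAlgebra n ξ a b :=
  RingQuot.mkAlgHom F (Rel n ξ a b) (FreeAlgebra.ι F 1)

theorem genX_pow : genX n ξ a b ^ n = algebraMap F _ a := by
  have := RingQuot.mkAlgHom_rel F (Rel.x_pow (n := n) (ξ := ξ) (a := a) (b := b))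
  rwa [map_pow, AlgHom.commutes] at this

theorem genY_pow : genY n ξ a b ^ n = algebraMap F _ b := by
  have := RingQuot.mkAlgHom_rel F (Rel.y_pow (n := n) (ξ := ξ) (a := a) (b := b))
  rwa [map_pow, AlgHom.commutes] at this

theorem genY_mul_genX :
    genY n ξ a b * genX n ξ a b = ξ • (genX n ξ a b * genY n ξ a b) := by
  have := RingQuot.mkAlgHom_rel F (Rel.comm (n := n) (ξ := ξ) (a := a) (b := b))
  rwa [map_smul, map_mul, map_mul] at this

/-- The monomials `x ^ i y ^ j` with `i, j < n` span the symbol algebra. -/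
theorem span_monomials {n : ℕ} (hn : 0 < n) :
    Submodule.span F (Set.range fun p : Fin n × Fin n ↦
      genX n ξ a b ^ (p.1 : ℕ) * genY n ξ a b ^ (p.2 : ℕ)) = ⊤ := by
  set x := genX n ξ a b with hxdef
  set y := genY n ξ a b with hydef
  have hx : x ^ n = algebraMap F _ a := genX_pow n ξ a b
  have hy : y ^ n = algebraMap F _ b := genY_pow n ξ a b
  have h : y * x = ξ • (x * y) := genY_mul_genX n ξ a b
  set S := Submodule.span F (Set.range fun p : Fin n × Fin n ↦ x ^ (p.1 : ℕ) * y ^ (p.2 : ℕ))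
  have hmem (i j : ℕ) (hi : i < n) (hj : j < n) : x ^ i * y ^ j ∈ S :=
    Submodule.subset_span ⟨(⟨i, hi⟩, ⟨j, hj⟩), rfl⟩
  have hX (s) (hs : s ∈ S) : x * s ∈ S := by
    have : S ≤ S.comap (LinearMap.mulLeft F x) := by
      refine Submodule.span_le.2 ?_
      rintro _ ⟨⟨⟨i, hi⟩, ⟨j, hj⟩⟩, rfl⟩
      change x * (x ^ i * y ^ j) ∈ S
      rw [← mul_assoc, ← pow_succ']
      rcases (Nat.succ_le_of_lt hi).lt_or_eq with hi' | hi'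
      · exact hmem _ _ hi' hj
      · have h0 := hmem 0 j hn hj
        rw [pow_zero, one_mul] at h0
        rw [show i + 1 = n from hi', hx, ← Algebra.smul_def]
        exact S.smul_mem _ h0
    exact this hs
  have hY (s) (hs : s ∈ S) : y * s ∈ S := by
    have : S ≤ S.comap (LinearMap.mulLeft F y) := by
      refine Submodule.span_le.2 ?_
      rintro _ ⟨⟨⟨i, hi⟩, ⟨j, hj⟩⟩, rfl⟩
      change y * (x ^ i * y ^ j) ∈ S
      rw [← mul_assoc, mul_pow_of_comm h, smul_mul_assoc, mul_assoc, ← pow_succ']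
      refine S.smul_mem _ ?_
      rcases (Nat.succ_le_of_lt hj).lt_or_eq with hj' | hj'
      · exact hmem _ _ hi hj'
      · have h0 := hmem i 0 hi hn
        rw [pow_zero, mul_one] at h0
        rw [show j + 1 = n from hj', hy, ← Algebra.commutes, ← Algebra.smul_def]
        exact S.smul_mem _ h0
    exact this hs
  -- The span is thus a left ideal; it contains `1`, hence is everything.
  have hall (w : FreeAlgebra F (Fin 2)) : ∀ s ∈ S, RingQuot.mkAlgHom F (Rel n ξ a b) w * s ∈ S := by
    induction w using FreeAlgebra.induction with
    | grade0 r =>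
      intro s hs
      rw [AlgHom.commutes, ← Algebra.smul_def]
      exact S.smul_mem _ hs
    | grade1 i =>
      fin_cases i
      exacts [hX, hY]
    | mul u v hu hv =>
      intro s hs
      rw [map_mul, mul_assoc]
      exact hu _ (hv _ hs)
    | add u v hu hv =>
      intro s hs
      rw [map_add, add_mul]
      exact S.add_mem (hu _ hs) (hv _ hs)
  rw [eq_top_iff]
  rintro w -
  obtain ⟨w, rfl⟩ := RingQuot.mkAlgHom_surjective F (Rel n ξ a b) w
  have h1 := hall w 1 (by simpa using hmem 0 0 hn hn)
  rwa [mul_one] at h1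

variable {n ξ a b}

/-- The homomorphism out of a symbol algebra given by a solution of the defining relations. -/
noncomputable def lift {A : Type*} [Ring A] [Algebra F A] {x y : A}
    (hx : x ^ n = algebraMap F A a) (hy : y ^ n = algebraMap F A b)
    (h : y * x = ξ • (x * y)) : SymbolAlgebra n ξ a b →ₐ[F] A :=
  RingQuot.liftAlgHom F ⟨FreeAlgebra.lift F ![x, y], by
    rintro _ _ (_ | _ | _)
    · simpa using hx
    · simpa using hy
    · simpa using h⟩

theorem lift_genX {A : Type*} [Ring A] [Algebra F A] {x y : A}
    (hx : x ^ n = algebraMap F A a) (hy : y ^ n = algebraMap F A b)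
    (h : y * x = ξ • (x * y)) : lift hx hy h (genX n ξ a b) = x := by
  simp [lift, genX]

theorem lift_genY {A : Type*} [Ring A] [Algebra F A] {x y : A}
    (hx : x ^ n = algebraMap F A a) (hy : y ^ n = algebraMap F A b)
    (h : y * x = ξ • (x * y)) : lift hx hy h (genY n ξ a b) = y := by
  simp [lift, genY]

/-- A symbol algebra of degree `n` splits as soon as it acts on an `n`-dimensional space. -/
theorem isSplitAlgebra_of_end {V : Type*} [AddCommGroup V] [Module F V] (hn : 0 < n)
    (hV : Module.finrank F V = n) (hξ : IsPrimitiveRoot ξ n) (ha : a ≠ 0) (hb : b ≠ 0)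
    {x y : Module.End F V} (hx : x ^ n = algebraMap F _ a) (hy : y ^ n = algebraMap F _ b)
    (h : y * x = ξ • (x * y)) : IsSplitAlgebra F (SymbolAlgebra n ξ a b) := by
  have : Module.Finite F V := Module.finite_of_finrank_pos (hV ▸ hn)
  have : Nontrivial V := Module.nontrivial_of_finrank_pos (R := F) (hV ▸ hn)
  have hli := linearIndependent_monomials hn hξ ha hb hx hy h
  set φ := lift hx hy h
  have hφ (p : Fin n × Fin n) : φ (genX n ξ a b ^ (p.1 : ℕ) * genY n ξ a b ^ (p.2 : ℕ)) =
      x ^ (p.1 : ℕ) * y ^ (p.2 : ℕ) := by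
    rw [map_mul, map_pow, map_pow, lift_genX, lift_genY]
  have hinj : Function.Injective φ := by
    rw [injective_iff_map_eq_zero]
    intro w hw
    obtain ⟨c, rfl⟩ := (Submodule.mem_span_range_iff_exists_fun F).1
      (span_monomials ξ a b hn ▸ Submodule.mem_top : w ∈ _)
    simp_rw [map_sum, map_smul, hφ] at hw
    simp [Fintype.linearIndependent_iff.1 hli c hw]
  have hsurj : Function.Surjective φ := by
    have htop := hli.span_eq_top_of_card_eq_finrank' (by
      rw [Module.finrank_linearMap, hV, Fintype.card_prod, Fintype.card_fin])
    have : (⊤ : Submodule F (Module.End F V)) ≤ LinearMap.range φ.toLinearMap := by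
      rw [← htop, Submodule.span_le]
      rintro _ ⟨p, rfl⟩
      exact ⟨_, hφ p⟩
    intro w
    exact this (Submodule.mem_top : w ∈ _)
  exact ⟨n, hn, ⟨(AlgEquiv.ofBijective φ ⟨hinj, hsurj⟩).trans
    (algEquivMatrix (Module.finBasisOfFinrankEq F V hV))⟩⟩

end SymbolAlgebra

/-! ### Splitting by norms -/

namespace SymbolAlgebra

variable {F : Type*} [Field F]

/-- A symbol algebra `(θ ^ n, N ρ)` acts on a commutative algebra containing `θ` and `ρ`, where
the norm is taken along an automorphism `σ` with `σ θ = ξ θ`. -/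
theorem isSplitAlgebra_of_algHom {A : Type*} [CommRing A] [Algebra F A] {n : ℕ} (hn : 0 < n)
    (hA : Module.finrank F A = n) {ξ a b : F} (hξ : IsPrimitiveRoot ξ n) (ha : a ≠ 0)
    (hb : b ≠ 0) (σ : A →ₐ[F] A) (hσ : σ ^ n = 1) {θ ρ : A} (hθ : θ ^ n = algebraMap F A a)
    (hσθ : σ θ = ξ • θ) (hρ : ∏ i ∈ Finset.range n, (σ ^ i) ρ = algebraMap F A b) :
    IsSplitAlgebra F (SymbolAlgebra n ξ a b) := by
  have hy (k : ℕ) (v : A) : ((LinearMap.mulLeft F ρ ∘ₗ σ.toLinearMap : Module.End F A) ^ k) v =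
      (∏ i ∈ Finset.range k, (σ ^ i) ρ) * (σ ^ k) v := by
    induction k generalizing v with
    | zero => simp
    | succ k ih =>
      rw [pow_succ, Module.End.mul_apply, ih, Finset.prod_range_succ, pow_succ σ,
        AlgHom.mul_apply, mul_assoc, ← map_mul]
      rfl
  refine isSplitAlgebra_of_end (x := LinearMap.mulLeft F θ)
    (y := LinearMap.mulLeft F ρ ∘ₗ σ.toLinearMap) hn hA hξ ha hb ?_ ?_ ?_
  · ext v
    rw [LinearMap.pow_mulLeft, LinearMap.mulLeft_apply, hθ, Module.algebraMap_end_apply,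
      Algebra.smul_def]
  · ext v
    rw [hy, hρ, hσ, Module.algebraMap_end_apply, Algebra.smul_def, AlgHom.one_apply]
  · ext v
    change ρ * σ (θ * v) = ξ • (θ * (ρ * σ v))
    rw [map_mul, hσθ, smul_mul_assoc, mul_smul_comm, mul_left_comm]

/-- The symbol algebra `(c ^ n, b)` splits. -/
theorem isSplitAlgebra_pow {n : ℕ} (hn : 0 < n) {ξ b c : F} (hξ : IsPrimitiveRoot ξ n)
    (hc : c ≠ 0) (hb : b ≠ 0) : IsSplitAlgebra F (SymbolAlgebra n ξ (c ^ n) b) := by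
  have : NeZero n := ⟨hn.ne'⟩
  -- Cyclic shift on `F ^ n`. Below, `θ = (ξ ^ i c)` satisfies `σ θ = ξ θ`, and `ρ` is `b` at `0`
  -- and `1` elsewhere, so the product of its shifts is the constant `b`.
  let σ : (ZMod n → F) →ₐ[F] (ZMod n → F) :=
    AlgHom.pi fun i ↦ Pi.evalAlgHom F (fun _ : ZMod n ↦ F) (i + 1)
  have hσ (k : ℕ) (f : ZMod n → F) (i : ZMod n) : (σ ^ k) f i = f (i + k) := by
    induction k generalizing f with
    | zero => simp
    | succ k ih =>
      rw [pow_succ, AlgHom.mul_apply, ih]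
      change f (i + k + 1) = _
      rw [Nat.cast_succ, add_assoc]
  refine isSplitAlgebra_of_algHom (A := ZMod n → F) hn (by simp) hξ (pow_ne_zero n hc) hb
    σ ?_ (θ := fun i ↦ ξ ^ i.val * c) (ρ := Pi.mulSingle 0 b) ?_ ?_ ?_
  · ext f i
    rw [hσ, ZMod.natCast_self, add_zero, AlgHom.one_apply]
  · ext i
    simp [mul_pow, ← pow_mul, mul_comm _ n, pow_mul ξ n, hξ.pow_eq_one]
  · ext i
    change ξ ^ (i + 1).val * c = ξ * (ξ ^ i.val * c)
    rw [← mul_assoc, ← pow_succ']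
    congr 1
    rw [ZMod.val_add, ZMod.val_one_eq_one_mod, Nat.add_mod_mod]
    exact (pow_eq_pow_mod _ hξ.pow_eq_one).symm
  · ext i
    simp only [Finset.prod_apply, hσ, Pi.algebraMap_apply, Algebra.algebraMap_self_apply]
    rw [← Finset.prod_image (s := Finset.range n) (g := fun k : ℕ ↦ i + (k : ZMod n))
      (f := fun j ↦ (Pi.mulSingle 0 b : ZMod n → F) j)]
    · have himg : (Finset.range n).image (fun k : ℕ ↦ i + (k : ZMod n)) = Finset.univ := by
        refine Finset.eq_univ_of_forall fun j ↦ Finset.mem_image.2 ⟨(j - i).val, ?_, ?_⟩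
        · exact Finset.mem_range.2 (ZMod.val_lt _)
        · simp
      rw [himg, Finset.prod_pi_mulSingle']
      simp
    · intro k hk l hl hkl
      have := add_left_cancel hkl
      rw [ZMod.natCast_eq_natCast_iff'] at this
      rwa [Nat.mod_eq_of_lt (by simpa using hk), Nat.mod_eq_of_lt (by simpa using hl)] at this

open IntermediateField Polynomial in
/-- The symbol algebra `(a, N ρ)` splits, where `N` is the norm of the Kummer extension generated
by an `n`-th root of `a`. -/
theorem isSplitAlgebra_norm {L : Type*} [Field L] [Algebra F L] {n : ℕ} {ξ a : F}
    (hξ : IsPrimitiveRoot ξ n) (ha : a ≠ 0) (hirr : Irreducible (X ^ n - C a))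
    [IsSplittingField F L (X ^ n - C a)] {θ ρ : L} (hθ : θ ^ n = algebraMap F L a) (hρ : ρ ≠ 0) :
    IsSplitAlgebra F (SymbolAlgebra n ξ a (Algebra.norm F ρ)) := by
  have hn : 0 < n := Nat.pos_of_ne_zero (ne_zero_of_irreducible_X_pow_sub_C hirr)
  have : NeZero n := ⟨hn.ne'⟩
  have hne : (primitiveRoots n F).Nonempty := ⟨ξ, (mem_primitiveRoots hn).2 hξ⟩
  have : IsGalois F L := isGalois_of_isSplittingField_X_pow_sub_C hne hirr L
  have : FiniteDimensional F L := IsSplittingField.finiteDimensional L (X ^ n - C a)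
  let e := autEquivZmod hirr L hξ
  let σ : Gal(L/F) := e.symm (Multiplicative.ofAdd 1)
  have hσ (k : ℕ) : σ ^ k = e.symm (Multiplicative.ofAdd (k : ZMod n)) := by
    rw [← map_pow, ← ofAdd_nsmul, nsmul_one]
  have hcoe (k : ℕ) : (σ : L →ₐ[F] L) ^ k = ((σ ^ k : Gal(L/F)) : L →ₐ[F] L) := by
    induction k with
    | zero => rfl
    | succ k ih => rw [pow_succ, pow_succ, ih]; rfl
  refine isSplitAlgebra_of_algHom hn (finrank_of_isSplittingField_X_pow_sub_C hne hirr L) hξ ha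
    (Algebra.norm_ne_zero_iff.2 hρ) (σ : L →ₐ[F] L) ?_ hθ ?_ (ρ := ρ) ?_
  · rw [hcoe, hσ, ZMod.natCast_self, ofAdd_zero, map_one]
    rfl
  · simpa using autEquivZmod_symm_apply_natCast hirr L hθ hξ 1
  · rw [Algebra.norm_eq_prod_automorphisms]
    refine Finset.prod_bij (fun k _ ↦ σ ^ k) (by simp) ?_ ?_ ?_
    · intro k hk l hl hkl
      rw [hσ, hσ, e.symm.injective.eq_iff, Multiplicative.ofAdd.injective.eq_iff,
        ZMod.natCast_eq_natCast_iff'] at hkl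
      rwa [Nat.mod_eq_of_lt (by simpa using hk), Nat.mod_eq_of_lt (by simpa using hl)] at hkl
    · intro τ _
      refine ⟨(e τ).toAdd.val, Finset.mem_range.2 (ZMod.val_lt _), ?_⟩
      rw [hσ, ZMod.natCast_zmod_val, ofAdd_toAdd, MulEquiv.symm_apply_apply]
    · intro k _
      rw [hcoe]
      rfl

end SymbolAlgebra

/-! ### Decomposition groups and norms of ideals -/

section NormOfIdeal

open Ideal Pointwise

variable {K L : Type*} [Field K] [NumberField K] [Field L] [NumberField L] [Algebra K L]

/-- If a prime `P` above a principal prime `(π)` has trivial decomposition group, then the norm of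
a generator of a power of `P` is, up to a unit, that power of `π`. -/
theorem exists_norm_eq_unit_mul_pow [IsGalois K L] {π : 𝓞 K} (hπ : Prime π) (P : Ideal (𝓞 L))
    [P.IsPrime] [P.LiesOver (span {π})] (hstab : MulAction.stabilizer Gal(L/K) P = ⊥)
    {m : ℕ} {ρ : 𝓞 L} (hρ : P ^ m = span {ρ}) :
    ∃ u : (𝓞 K)ˣ, Algebra.norm K (ρ : L) = ((u : 𝓞 K) : K) * (π : K) ^ m := by
  have hprime : (span {π}).IsPrime := (span_singleton_prime hπ.ne_zero).2 hπ
  have hmax : (span {π}).IsMaximal :=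
    hprime.isMaximal (by simpa [span_singleton_eq_bot] using hπ.ne_zero)
  have : P.IsMaximal := IsMaximal.of_liesOver_isMaximal P (span {π})
  have : Finite (𝓞 K ⧸ span {π}) :=
    finiteQuotientOfFreeOfNeBot _ (by simpa [span_singleton_eq_bot] using hπ.ne_zero)
  have hcard := card_stabilizer_eq_card_inertia_mul_finrank (G := Gal(L/K)) (span {π}) P
  rw [hstab, Nat.card_unique] at hcard
  -- The residue degree divides the order of the decomposition group, which is `1`.
  have hdeg : P.inertiaDeg (𝓞 K) = 1 := Nat.eq_one_of_mul_eq_one_left hcard.symm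
  have hnorm : relNorm (𝓞 K) P = span {π} := by
    rw [relNorm_eq_pow_of_isMaximal P (span {π}), hdeg, pow_one]
  have h := congr_arg (relNorm (𝓞 K)) hρ
  rw [map_pow, hnorm, relNorm_singleton, span_singleton_pow, span_singleton_eq_span_singleton] at h
  obtain ⟨u, hu⟩ := h
  refine ⟨u, ?_⟩
  rw [← Algebra.algebraMap_intNorm (A := 𝓞 K) (B := 𝓞 L) (K := K) (L := L) ρ, ← hu, map_mul, map_pow,
    mul_comm]

open IntermediateField in
/-- In a Kummer extension generated by an `n`-th root of `α`, the decomposition group of a prime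
not dividing `n` modulo which `α` is an `n`-th power residue is trivial. -/
theorem stabilizer_eq_bot_of_isPowerResidueMod [IsGalois K L] {n : ℕ} (hn : n.Prime) {ξ : K}
    (hξ : IsPrimitiveRoot ξ n) {α : K} {θ : L} (hθ : θ ^ n = algebraMap K L α) (hL : K⟮θ⟯ = ⊤)
    {π : 𝓞 K} (hπ : Prime π) (hπn : ¬ π ∣ n) (hres : IsPowerResidueMod n π α)
    (P : Ideal (𝓞 L)) [P.IsPrime] [P.LiesOver (span {π})] :
    MulAction.stabilizer Gal(L/K) P = ⊥ := by
  have : NeZero n := ⟨hn.ne_zero⟩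
  have : SMulCommClass Gal(L/K) (𝓞 K) (𝓞 L) := (inferInstance :
    IsGaloisGroup Gal(L/K) (𝓞 K) (𝓞 L)).commutes
  have hmem (z : 𝓞 K) : algebraMap (𝓞 K) (𝓞 L) z ∈ P ↔ π ∣ z := by
    rw [← mem_span_singleton, P.mem_of_liesOver (span {π})]
  obtain ⟨a, b, x, ha, hb, hab, hdvd⟩ := hres
  have hb0 : b ≠ 0 := fun h ↦ hb (h ▸ dvd_zero π)
  -- Scaling by `b` clears the denominator of `α`, making `θ b` integral.
  have hηn : (θ * algebraMap K L b) ^ n = 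
      ((algebraMap (𝓞 K) (𝓞 L) (b ^ (n - 1) * a) : 𝓞 L) : L) := by
    have h1 : α * (b : K) ^ n = ((b ^ (n - 1) * a : 𝓞 K) : K) := by
      change α * algebraMap (𝓞 K) K b ^ n = algebraMap (𝓞 K) K (b ^ (n - 1) * a)
      rw [map_mul, map_pow, ← hab, mul_left_comm, pow_sub_one_mul hn.ne_zero]
    rw [mul_pow, hθ, ← map_pow, ← map_mul, h1]
    rfl
  have hint : IsIntegral ℤ (θ * algebraMap K L b) :=
    IsIntegral.of_pow hn.pos (hηn ▸ NumberField.RingOfIntegers.isIntegral_coe _)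
  obtain ⟨η, hη⟩ : ∃ η : 𝓞 L, (η : L) = θ * algebraMap K L b := ⟨⟨_, hint⟩, rfl⟩
  rw [← hη] at hηn
  have hηn' : η ^ n = algebraMap (𝓞 K) (𝓞 L) (b ^ (n - 1) * a) := by
    ext
    rw [← hηn]
    rfl
  have hηP : η ∉ P := fun h ↦ by
    have := P.pow_mem_of_mem h n hn.pos
    rw [hηn', hmem] at this
    exact (hπ.dvd_or_dvd this).elim (fun h ↦ hb (hπ.dvd_of_dvd_pow h)) ha
  let ζ : 𝓞 L := algebraMap (𝓞 K) (𝓞 L) hξ.toInteger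
  have hζ : IsPrimitiveRoot ζ n :=
    hξ.toInteger_isPrimitiveRoot.map_of_injective
      (FaithfulSMul.algebraMap_injective (𝓞 K) (𝓞 L))
  have hσroot (σ : Gal(L/K)) (ν : 𝓞 L) (hν : ν ^ n = 1) : σ • ν = ν := by
    obtain ⟨i, -, rfl⟩ := hζ.eq_pow_of_pow_eq_one hν
    rw [smul_pow', smul_algebraMap]
  -- `η` is congruent to an element of `𝓞 K` modulo `P`
  obtain ⟨μ, hμ, hμP⟩ : ∃ μ : 𝓞 L, μ ^ n = 1 ∧
      η - μ * algebraMap (𝓞 K) (𝓞 L) (b * x) ∈ P := by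
    -- The residue condition gives `η ^ n ≡ (b x) ^ n` modulo `P`; factor the difference over the
    -- roots of unity and use that `P` is prime.
    have hprod : η ^ n - algebraMap (𝓞 K) (𝓞 L) (b * x) ^ n ∈ P := by
      rw [hηn', ← map_pow, ← map_sub, hmem]
      refine hdvd.trans ⟨b ^ (n - 1), ?_⟩
      rw [mul_pow]
      nth_rw 2 [← Nat.sub_add_cancel hn.one_le]
      rw [pow_succ]
      ring
    rw [hζ.pow_sub_pow_eq_prod_sub_mul _ _ hn.pos, IsPrime.prod_mem_iff] at hprod
    obtain ⟨μ, hμ, hμP⟩ := hprod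
    exact ⟨μ, (Polynomial.mem_nthRootsFinset hn.pos _).1 hμ, hμP⟩
  rw [eq_bot_iff]
  intro σ hσ
  rw [MulAction.mem_stabilizer_iff] at hσ
  have hση : σ • η - η ∈ P := by
    have h1 : σ • (η - μ * algebraMap (𝓞 K) (𝓞 L) (b * x)) ∈ P :=
      hσ.le (smul_mem_pointwise_smul σ _ P hμP)
    rw [smul_sub, smul_mul', hσroot σ μ hμ, smul_algebraMap] at h1
    have := P.sub_mem h1 hμP
    rwa [sub_sub_sub_cancel_right] at this
  -- `σ η = ν η` for a root of unity `ν`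
  obtain ⟨i, -, hi⟩ : ∃ i < n, ζ ^ i * η = σ • η := by
    have hpow : (σ • η) ^ n = η ^ n := by
      rw [← smul_pow', hηn', smul_algebraMap]
    have h1 := hζ.nthRoots_eq (rfl : η ^ n = η ^ n)
    have h2 := (Polynomial.mem_nthRoots hn.pos).2 hpow
    rw [h1, Multiset.mem_map] at h2
    simpa only [Multiset.mem_range] using h2
  have hfix : σ • η = η := by
    by_cases hν : hξ.toInteger ^ i = 1
    · rw [← hi, ← map_pow, hν, map_one, one_mul]
    -- A root of unity `ν ≠ 1` with `ν ≡ 1` modulo `π` would give `0 = ∑ ν ^ j ≡ n`, against `π ∤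
    -- n`.
    · exfalso
      have hdiv : π ∣ hξ.toInteger ^ i - 1 := by
        rw [← hi, ← sub_one_mul] at hση
        rw [← hmem, map_sub, map_pow, map_one]
        exact (IsPrime.mem_or_mem ‹_› hση).resolve_right hηP
      have hgeom : ∑ j ∈ Finset.range n, (hξ.toInteger ^ i) ^ j = 0 := by
        have := geom_sum_mul (hξ.toInteger ^ i) n
        rw [← pow_mul, mul_comm i n, pow_mul, hξ.toInteger_isPrimitiveRoot.pow_eq_one, one_pow,
          sub_self] at this
        exact (mul_eq_zero.1 this).resolve_right (sub_ne_zero.2 hν)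
      have hsum : π ∣ ∑ j ∈ Finset.range n, ((hξ.toInteger ^ i) ^ j - 1) :=
        Finset.dvd_sum fun j _ ↦ hdiv.trans (sub_one_dvd_pow_sub_one _ _)
      rw [Finset.sum_sub_distrib, hgeom, zero_sub, dvd_neg] at hsum
      exact hπn (by simpa using hsum)
  have hσθ : σ θ = θ := by
    have h1 : σ (η : L) = η := congr_arg (algebraMap (𝓞 L) L) hfix
    rw [hη, map_mul, AlgEquiv.commutes] at h1
    refine mul_right_cancel₀ ?_ h1
    simpa using hb0
  have hadj : Algebra.adjoin K {θ} = ⊤ := by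
    rw [← adjoin_simple_toSubalgebra_of_isAlgebraic (Algebra.IsAlgebraic.isAlgebraic θ), hL,
      top_toSubalgebra]
  have hext : (σ : L →ₐ[K] L) = AlgHom.id K L :=
    AlgHom.ext_of_adjoin_eq_top hadj (by rintro _ rfl; exact hσθ)
  rw [Subgroup.mem_bot]
  ext z
  exact DFunLike.congr_fun hext z

end NormOfIdeal

/-! ### Assembly over the rings of integers, then over `ℤ[ξ]` -/

open IntermediateField Polynomial in
/-- The ring of integers version of the splitting criterion. -/
theorem exists_isSplitAlgebra_unit_mul_pow {K L : Type*} [Field K] [NumberField K] [Field L]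
    [NumberField L] [Algebra K L] {q : ℕ} (hq : q.Prime) {ξ : K} (hξ : IsPrimitiveRoot ξ q)
    {α : K} (hα : α ≠ 0) {θ : L} (hθ : θ ^ q = algebraMap K L α) (hL : K⟮θ⟯ = ⊤)
    {π : 𝓞 K} (hπ : Prime π) (hπq : ¬ π ∣ q) (hres : IsPowerResidueMod q π α)
    (P : (Ideal (𝓞 L))⁰) [(P : Ideal (𝓞 L)).IsPrime]
    [(P : Ideal (𝓞 L)).LiesOver (Ideal.span {π})] :
    (∃ u : (𝓞 K)ˣ, IsSplitAlgebra K (SymbolAlgebra q ξ α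
      (((u : 𝓞 K) : K) * (π : K) ^ orderOf (ClassGroup.mk0 P)))) ∧
    (∃ u : (𝓞 K)ˣ, IsSplitAlgebra K (SymbolAlgebra q ξ α
      (((u : 𝓞 K) : K) * (π : K) ^ Nat.gcd (orderOf (ClassGroup.mk0 P)) q))) := by
  have hπ0 : (π : K) ≠ 0 := by simpa using hπ.ne_zero
  -- When `α` is a `q`-th power, `L = K` is too small to act on, but every second slot splits.
  by_cases hpow : ∃ c : K, c ^ q = α
  · obtain ⟨c, rfl⟩ := hpow
    have hsplit (m : ℕ) : IsSplitAlgebra K (SymbolAlgebra q ξ (c ^ q)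
        (((1 : (𝓞 K)ˣ) : K) * (π : K) ^ m)) :=
      SymbolAlgebra.isSplitAlgebra_pow hq.pos hξ (by rintro rfl; simp [hq.ne_zero] at hα)
        (mul_ne_zero (by simp) (pow_ne_zero _ hπ0))
    exact ⟨⟨1, hsplit _⟩, ⟨1, hsplit _⟩⟩
  have hirr : Irreducible (X ^ q - C α) :=
    X_pow_sub_C_irreducible_of_prime hq fun c hc ↦ hpow ⟨c, hc⟩
  have hrank : Module.finrank K L = q := by
    rw [← finrank_top', ← hL, adjoin.finrank (Algebra.IsIntegral.isIntegral θ),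
      ← minpoly.eq_of_irreducible_of_monic hirr (by simp [hθ])
        (monic_X_pow_sub_C α hq.ne_zero), natDegree_X_pow_sub_C]
  have hne : (primitiveRoots q K).Nonempty := ⟨ξ, (mem_primitiveRoots hq.pos).2 hξ⟩
  have : IsSplittingField K L (X ^ q - C α) := by
    subst hrank
    exact isSplittingField_X_pow_sub_C_of_root_adjoin_eq_top hne hθ hL
  have : IsGalois K L := isGalois_of_isSplittingField_X_pow_sub_C hne hirr L
  have hsplit {ρ : L} (hρ : ρ ≠ 0) :
      IsSplitAlgebra K (SymbolAlgebra q ξ α (Algebra.norm K ρ)) :=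
    SymbolAlgebra.isSplitAlgebra_norm hξ hα hirr hθ hρ
  have hstab := stabilizer_eq_bot_of_isPowerResidueMod hq hξ hθ hL hπ hπq hres (P : Ideal (𝓞 L))
  set h := orderOf (ClassGroup.mk0 P) with hh
  obtain ⟨ρ, hρ⟩ : ∃ ρ, (P : Ideal (𝓞 L)) ^ h = Ideal.span {ρ} := by
    have h1 : ClassGroup.mk0 (P ^ h) = 1 := by rw [map_pow, hh, pow_orderOf_eq_one]
    rw [ClassGroup.mk0_eq_one_iff (P ^ h).2] at h1
    exact ⟨_, (Submodule.IsPrincipal.principal (S := (P : Ideal (𝓞 L)) ^ h)).choose_spec⟩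
  obtain ⟨u, hu⟩ := exists_norm_eq_unit_mul_pow hπ (P : Ideal (𝓞 L)) hstab hρ
  have hnorm0 : Algebra.norm K (ρ : L) ≠ 0 := by
    rw [hu]
    exact mul_ne_zero (by simp) (pow_ne_zero _ hπ0)
  have hρ0 : (ρ : L) ≠ 0 := Algebra.norm_ne_zero_iff.1 hnorm0
  refine ⟨⟨u, hu ▸ hsplit hρ0⟩, ?_⟩
  have hnormπ : Algebra.norm K (algebraMap K L π) = (π : K) ^ q := by
    rw [Algebra.norm_algebraMap, hrank]
  have hπL : algebraMap K L π ≠ 0 := by simpa using hπ.ne_zero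
  -- With `h A + q B = gcd(h, q)`, the element `ρ ^ A π ^ B` has norm `u ^ A π ^ gcd(h, q)`. The
  -- Bézout coefficients may be negative, hence integer powers.
  refine ⟨u ^ Nat.gcdA h q, ?_⟩
  have key : Algebra.norm K ((ρ : L) ^ Nat.gcdA h q * algebraMap K L π ^ Nat.gcdB h q) =
      (((u ^ Nat.gcdA h q : (𝓞 K)ˣ) : 𝓞 K) : K) * (π : K) ^ Nat.gcd h q := by
    have hcoe : (((u ^ Nat.gcdA h q : (𝓞 K)ˣ) : 𝓞 K) : K) = ((u : 𝓞 K) : K) ^ Nat.gcdA h q := by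
      have := congr_arg Units.val (map_zpow (Units.map (algebraMap (𝓞 K) K : 𝓞 K →* K)) u
        (Nat.gcdA h q))
      rwa [Units.val_zpow_eq_zpow_val] at this
    have hzpow (z : L) (k : ℤ) : Algebra.norm K (z ^ k) = Algebra.norm K z ^ k :=
      map_zpow₀ ({ Algebra.norm K with map_zero' := Algebra.norm_zero } : L →*₀ K) z k
    rw [map_mul, hzpow, hzpow, hu, hnormπ, mul_zpow, hcoe, mul_assoc,
      ← zpow_natCast (π : K) h, ← zpow_natCast (π : K) q, ← zpow_mul, ← zpow_mul,
      ← zpow_add₀ hπ0, ← Nat.gcd_eq_gcd_ab, zpow_natCast]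
  rw [← key]
  exact hsplit (mul_ne_zero (zpow_ne_zero _ hρ0) (zpow_ne_zero _ hπL))

/-- Since `ℤ[ξ]` is the integral closure of `ℤ` in the cyclotomic field `K`, all the data transport
to `𝓞 K` and the units transport back. -/
theorem proposition3p6
    (q : ℕ) (hq : q.Prime) (hq_odd : Odd q)
    -- `K = ℚ(ξ)`
    {K : Type*} [Field K] [NumberField K] [IsCyclotomicExtension {q} ℚ K]
    (ξ : K) (hξ : IsPrimitiveRoot ξ q)
    (α : K) (hα : α ≠ 0)
    -- `L = K(√[q] α)`
    {L : Type*} [Field L] [NumberField L] [Algebra K L]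
    (θ : L) (hθ : θ ^ q = algebraMap K L α) (hL : IntermediateField.adjoin K {θ} = ⊤)
    -- a prime element `π` of `ℤ[ξ]`, not above `q`
    (π : Algebra.adjoin ℤ {ξ}) (hπ : Prime π) (hπq : ¬ π ∣ (q : Algebra.adjoin ℤ {ξ}))
    (hres : IsPowerResidueMod q π α)
    -- `πL` is `π` as an element of `𝓞 L`
    (πL : 𝓞 L) (hπL : (πL : L) = algebraMap K L (π : K))
    -- any prime ideal `P` of `𝓞 L` dividing `π 𝓞 L`, and the order of its class
    (P : (Ideal (𝓞 L))⁰) (hP : (P : Ideal (𝓞 L)).IsPrime)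
    (hPπ : (P : Ideal (𝓞 L)) ∣ Ideal.span {πL})
    (h : ℕ) (hord : h = orderOf (ClassGroup.mk0 P)) :
    (∃ u : (Algebra.adjoin ℤ {ξ})ˣ,
      IsSplitAlgebra K
        (SymbolAlgebra q ξ α (((u : Algebra.adjoin ℤ {ξ}) : K) * (π : K) ^ h))) ∧
    (∃ u : (Algebra.adjoin ℤ {ξ})ˣ,
      IsSplitAlgebra K
        (SymbolAlgebra q ξ α
          (((u : Algebra.adjoin ℤ {ξ}) : K) * (π : K) ^ Nat.gcd h q))) := by
  have : NeZero q := ⟨hq.ne_zero⟩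
  have hcl : IsIntegralClosure (Algebra.adjoin ℤ {ξ}) ℤ K :=
    IsCyclotomicExtension.Rat.isIntegralClosure_adjoin_singleton hξ
  let e : Algebra.adjoin ℤ {ξ} ≃ₐ[ℤ] 𝓞 K :=
    IsIntegralClosure.equiv ℤ (Algebra.adjoin ℤ {ξ}) K (𝓞 K)
  have he (z : Algebra.adjoin ℤ {ξ}) : ((e z : 𝓞 K) : K) = z :=
    IsIntegralClosure.algebraMap_equiv ℤ (Algebra.adjoin ℤ {ξ}) K (𝓞 K) z
  have hprime : Prime (e π) := (MulEquiv.prime_iff e.toMulEquiv).2 hπ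
  have hprimeq : ¬ e π ∣ (q : 𝓞 K) := by
    rwa [← map_natCast e q, map_dvd_iff e]
  have hres' : IsPowerResidueMod q (e π) α := by
    obtain ⟨a, b, x, ha, hb, hab, hdvd⟩ := hres
    refine ⟨e a, e b, e x, by rwa [map_dvd_iff e], by rwa [map_dvd_iff e], ?_, ?_⟩
    · change α * ((e b : 𝓞 K) : K) = ((e a : 𝓞 K) : K)
      rw [he, he]
      exact hab
    · rw [← map_pow, ← map_mul, ← map_sub]
      exact map_dvd e hdvd
  have hπP : algebraMap (𝓞 K) (𝓞 L) (e π) ∈ (P : Ideal (𝓞 L)) := by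
    have h1 : algebraMap (𝓞 K) (𝓞 L) (e π) = πL := by
      ext
      rw [hπL, ← he]
      rfl
    rw [h1]
    exact Ideal.dvd_span_singleton.1 hPπ
  have hlies : (P : Ideal (𝓞 L)).LiesOver (Ideal.span {e π}) := by
    have hmax : (Ideal.span {e π}).IsMaximal :=
      ((Ideal.span_singleton_prime hprime.ne_zero).2 hprime).isMaximal
        (by simpa [Ideal.span_singleton_eq_bot] using hπ.ne_zero)
    refine ⟨hmax.eq_of_le (Ideal.comap_ne_top _ hP.ne_top) ?_⟩
    rw [Ideal.span_singleton_le_iff_mem]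
    exact hπP
  have hunit (u : (𝓞 K)ˣ) : ((Units.mapEquiv e.symm.toMulEquiv u : Algebra.adjoin ℤ {ξ}) : K) =
      ((u : 𝓞 K) : K) := by
    rw [← he]
    exact congr_arg (algebraMap (𝓞 K) K) (e.apply_symm_apply _)
  obtain ⟨⟨u, hu⟩, ⟨v, hv⟩⟩ :=
    exists_isSplitAlgebra_unit_mul_pow hq hξ hα hθ hL hprime hprimeq hres' P
  rw [← hord, he, ← hunit] at hu hv
  exact ⟨⟨_, hu⟩, ⟨_, hv⟩⟩
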